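/- Notation. For a set $S\subset\mathbb{R}^n$ and $t>0$ let $w_t(S)=\mathbb{E}\sup_{x\in S,\ \|x\|_2\le t}\langle g,x\rangle$ with $g\sim\mathcal N(0,I_n)$ be the local mean width, and let $d_t(S)=w_t(S)^2/t^2$. Model. Let $a_1,\dots,a_m\sim\mathcal N(0,I_n)$ be independent, let $\mathcal Y\subset\mathbb{R}$ be closed, and let $f:\mathbb{R}\to\mathcal Y$ be a (possibly random, jointly measurable) function. Let $f_1,\dots,f_m$ be independent copies of $f$, independent of $a_1,\dots,a_m$. Put $y_i=f_i(\langle a_i,x_0\rangle)$, where $x_0\in\mathbb{R}^n$, $\|x_0\|_2=1$. Let $\tilde y=(\tilde y_1,\dots,\tilde y_m)\in\mathcal Y^m$ be arbitrary (it may be random and depend on all $a_i$ and $f_i$). Let $\mu\in\mathbb{R}$ and let $K\subset\mathbb{R}^n$ be any set (not necessarily convex) with $\mu x_0\in K$. Loss. Let $\mathcal L:\mathbb{R}\times\mathcal Y\to\mathbb{R}$ be convex and twice continuously differentiable in its first variable, with first and second derivatives $\mathcal L'$, $\mathcal L''$ in that variable, and suppose that there is a constant $C_{\mathcal L'}>0$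 with $|\mathcal L'(v,y)-\mathcal L'(v,\bar y)|\le C_{\mathcal L'}|y-\bar y|$ for all $v\in\mathbb{R}$, $y,\bar y\in\mathcal Y$. Let $$\bar{\mathcal L}_{\tilde y}(x)=\frac1m\sum_{i=1}^m\mathcal L(\langle a_i,x\rangle,\tilde y_i),\qquad \delta\bar{\mathcal L}_{\tilde y}(x,z)=\bar{\mathcal L}_{\tilde y}(x)-\bar{\mathcal L}_{\tilde y}(z)-\langle\nabla\bar{\mathcal L}_{\tilde y}(z),x-z\rangle .$$ Theorem. There are numerical constants $C_1,C_2,C_3,C_4>0$ and a function $R:(0,\infty)\to(0,\infty)$ such that the following holds for all data as above. Let $t>0$ and $0<M,N\le\infty$ with $M\ge\max\{32t,\,C_1|\mu|\}$, and let $C_{M,N}>0$ be such that $$\mathcal L''(v,y)\ge C_{M,N}\quad\text{for all }(v,y)\in(-M,M)\times\big((-N,N)\cap\mathcal Y\big).$$ If $m\ge C_3\cdot d_t(K-\mu x_0)$, then there is an event of probability at least $1-\exp(-C_4 m)$ on which the following is true: whenever $$N\ge C_2\,\mathbb{E}|f(g)|+\|y-\tilde y\|_\infty\quad\text{and}\quad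 N>\|y-\tilde y\|_\infty\qquad(g\sim\mathcal N(0,1)\text{ independent of }f),$$ the empirical loss satisfies restricted strong convexity at scale $t$ with respect to $\mu x_0$ and $K$, with constant $C_{\mathrm{RSC}}=R(C_{M,N})$ depending only on $C_{M,N}$: $$\delta\bar{\mathcal L}_{\tilde y}(x,\mu x_0)\ge C_{\mathrm{RSC}}\,\|x-\mu x_0\|_2^2\quad\text{for all }x\in K\cap(tS^{n-1}+\mu x_0).$$ In particular, if the two conditions on $N$ hold almost surely, then restricted strong convexity holds with probability at least $1-\exp(-C_4m)$. The second condition, $N>\|y-\tilde y\|_\infty$, follows from the first one unless $f(g)=0$ almost surely or $N=\infty$, and for $N=\infty$ it holds trivially. -/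

import Mathlib

open MeasureTheory ProbabilityTheory
open scoped ENNReal

noncomputable section

/-- The local mean width of `L ⊆ ℝⁿ` at scale `t`: the expectation of the supremum of `⟨g, x⟩` over
`x ∈ L ∩ t B₂ⁿ`, with `g` a standard Gaussian vector. -/
def localMeanWidth {n : ℕ} (t : ℝ) (L : Set (EuclideanSpace ℝ (Fin n))) : ℝ :=
  ∫ g, (⨆ x : ↥(L ∩ Metric.closedBall (0 : EuclideanSpace ℝ (Fin n)) t),
    inner ℝ g (x : EuclideanSpace ℝ (Fin n))) ∂(stdGaussian (EuclideanSpace ℝ (Fin n)))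

/-- The local effective dimension `d_t(L) = w_t(L)² / t²` (for `t > 0`). -/
def localEffectiveDim {n : ℕ} (t : ℝ) (L : Set (EuclideanSpace ℝ (Fin n))) : ℝ :=
  localMeanWidth t L ^ 2 / t ^ 2

/-- The random part of the single-index model with isotropic Gaussian measurements. The random
non-linearity is `f e : ℝ → Y` with a random parameter `e` of law `ν`; the `i`-th measurement uses
its own copy `f (ξ i)`. The pairs `(a i, ξ i)` are independent over `i`, and within each pair the
Gaussian vector and the non-linearity are independent. -/
structure IsGaussianSingleIndexModel {n m : ℕ} {Ω E : Type*} [MeasurableSpace Ω]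
    [MeasurableSpace E] {Y : Set ℝ} (P : Measure Ω) (ν : Measure E) (f : E → ℝ → Y)
    (a : Fin m → Ω → EuclideanSpace ℝ (Fin n)) (ξ : Fin m → Ω → E) : Prop where
  isClosed_range : IsClosed Y
  measurable_f : Measurable (Function.uncurry f)
  measurable_a : ∀ i, Measurable (a i)
  map_a : ∀ i, P.map (a i) = stdGaussian (EuclideanSpace ℝ (Fin n))
  measurable_ξ : ∀ i, Measurable (ξ i)
  map_ξ : ∀ i, P.map (ξ i) = ν
  indep_a_ξ : ∀ i, IndepFun (a i) (ξ i) P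
  indep : iIndepFun (fun i ω => (a i ω, ξ i ω)) P

/-- The observations (before adversarial noise) `yᵢ = fᵢ(⟨aᵢ, x₀⟩)` at the outcome `ω`. -/
def observation {n m : ℕ} {Ω E : Type*} {Y : Set ℝ} (f : E → ℝ → Y)
    (a : Fin m → Ω → EuclideanSpace ℝ (Fin n)) (ξ : Fin m → Ω → E)
    (x₀ : EuclideanSpace ℝ (Fin n)) (ω : Ω) (i : Fin m) : Y :=
  f (ξ i ω) (inner ℝ (a i ω) x₀)

/-- The mean `E|f(g)|`, with `g` standard normal and independent of `f`, as an element of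
`[0, ∞]`. -/
def meanAbsResponse {E : Type*} [MeasurableSpace E] {Y : Set ℝ} (ν : Measure E)
    (f : E → ℝ → Y) : ℝ≥0∞ :=
  ∫⁻ g, ∫⁻ e, ‖(f e g : ℝ)‖ₑ ∂ν ∂(gaussianReal 0 1)

/-- The sup-norm distance `‖y - y'‖_∞` of two observation vectors. -/
def supDist {m : ℕ} {Y : Set ℝ} (y y' : Fin m → Y) : ℝ≥0∞ :=
  ⨆ i, ‖(y i : ℝ) - (y' i : ℝ)‖ₑ

/-- The loss is continuously differentiable in the first variable, its derivative `L'(v, y)` is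
Lipschitz in `y` uniformly in `v`, and the loss is convex in the first variable. -/
structure IsRegularConvexLoss {Y : Set ℝ} (L : ℝ → Y → ℝ) : Prop where
  contDiff_one : ∀ y, ContDiff ℝ 1 (fun v => L v y)
  lipschitz_deriv : ∃ C : ℝ, 0 < C ∧ ∀ (v : ℝ) (y y' : Y),
    |deriv (fun u => L u y) v - deriv (fun u => L u y') v| ≤ C * |(y : ℝ) - (y' : ℝ)|
  convex : ∀ y, ConvexOn ℝ Set.univ (fun v => L v y)

/-- The empirical loss `x ↦ (1/m) ∑ᵢ L(⟨aᵢ, x⟩, yᵢ)`. -/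
def empiricalLoss {n m : ℕ} {Y : Set ℝ} (L : ℝ → Y → ℝ)
    (a : Fin m → EuclideanSpace ℝ (Fin n)) (y : Fin m → Y)
    (x : EuclideanSpace ℝ (Fin n)) : ℝ :=
  (1 / (m : ℝ)) * ∑ i, L (inner ℝ (a i) x) (y i)

/-- The linear Taylor approximation error of the empirical loss at `z`, evaluated at `x`. -/
def taylorError {n m : ℕ} {Y : Set ℝ} (L : ℝ → Y → ℝ)
    (a : Fin m → EuclideanSpace ℝ (Fin n)) (y : Fin m → Y)
    (x z : EuclideanSpace ℝ (Fin n)) : ℝ :=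
  empiricalLoss L a y x - empiricalLoss L a y z
    - inner ℝ (gradient (empiricalLoss L a y) z) (x - z)

/-- Restricted strong convexity of the empirical loss at scale `t` with respect to the point `z`
and the set `K`, with RSC-constant `C`. -/
def SatisfiesRSCWith {n m : ℕ} {Y : Set ℝ} (C : ℝ) (L : ℝ → Y → ℝ)
    (a : Fin m → EuclideanSpace ℝ (Fin n)) (y : Fin m → Y)
    (K : Set (EuclideanSpace ℝ (Fin n))) (z : EuclideanSpace ℝ (Fin n)) (t : ℝ) : Prop :=
  0 < C ∧ ∀ x ∈ K ∩ Metric.sphere z t, C * ‖x - z‖ ^ 2 ≤ taylorError L a y x z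

end

/-!
The empirical loss is strongly convex along a direction as soon as a fixed proportion of the
measurements sees that direction at a bounded, non-negligible size while staying in the region where
`L''` is bounded below. Write `x - μ x₀ = t v` with `‖v‖ = 1`. By convexity every summand of the
Taylor error is nonnegative, and it is at least `(c / 2) (t ⟨aᵢ, v⟩)²` if
`⟨aᵢ, μ x₀⟩` and `⟨aᵢ, x⟩` lie in `(-M, M)` and the corrupted response lies in `(-N, N)`
(`mul_sq_le_taylor_remainder`). The second condition and the one on `⟨aᵢ, μ x₀⟩` hold
unless the `i`-th measurement is *atypical* (`atypicalSet`): `|⟨aᵢ, x₀⟩|` or `|yᵢ|` is large, which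
does not depend on `v` and has small probability by Markov's inequality (`prod_atypicalSet_le`).
The condition `1 < ⟨aᵢ, v⟩ < 3` gives `(t ⟨aᵢ, v⟩)² ≥ t²` and keeps `⟨aᵢ, x⟩` within `3 t` of
`⟨aᵢ, μ x₀⟩`, hence in `(-M, M)`; its indicator is bounded below by the Lipschitz function
`tent ⟨aᵢ, v⟩`, whose mean `q > 0` is a numerical constant. So it suffices that, uniformly in `v`,
`∑ᵢ (tent ⟨aᵢ, v⟩ - 1{i atypical}) ≥ m q / 2` with high probability
(`exists_event_forall_sum_tent_ge`).

Put `F(z, v) = tent ⟨a, v⟩ - 1{z atypical}` for `z = (a, e)`. The exponential moment of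
`sup_v ∑ᵢ (𝔼 F(·, v) - F(zᵢ, v))` is estimated by replacing the independent summands one at a time.
In a single step, the mean of `sup_v (β_v + 𝔼 F(·, v) - F(z, v))` is at most that of
`sup_v (β_v + 2 ⟨g, v⟩)` with `g` standard Gaussian: this is symmetrization and contraction in one
stroke (`integral_iSup_sub_le_of_contraction`), and no random signs are needed because the Gaussian
law is itself symmetric. As `F` is bounded by `1`, Hoeffding's lemma turns this into an inequality
between exponential moments at the price of a factor `exp (b² / 2)`
(`lintegral_exp_gaussianMax_sub_le`). After `m` steps the Gaussian summands add up to `2 √m g`, and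
the exponent involves `2 √m w_t / t` (`lintegral_exp_gaussianMax_sum_le`), which is a small multiple
of `m` when `m` exceeds a large multiple of the local effective dimension. The Chernoff bound then
gives a probability of failure `exp (-C₄ m)` with a prefactor of `1`, even for small `m`.
-/

/-! ### Maxima of finite families -/

section FiniteMaximum

lemma le_iSup_of_fintype {ι : Type*} [Fintype ι] (α : ι → ℝ) (i : ι) : α i ≤ ⨆ j, α j :=
  le_ciSup (Finite.bddAbove_range α) i

variable {ι : Type*} [Fintype ι] [Nonempty ι]

lemma abs_iSup_sub_iSup_le {α β : ι → ℝ} {C : ℝ} (h : ∀ i, |α i - β i| ≤ C) :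
    |(⨆ i, α i) - ⨆ i, β i| ≤ C := by
  rw [abs_sub_le_iff]
  constructor
  · rw [sub_le_iff_le_add]
    refine ciSup_le fun i => ?_
    linarith [(abs_le.1 (h i)).2, le_iSup_of_fintype β i]
  · rw [sub_le_iff_le_add]
    refine ciSup_le fun i => ?_
    linarith [(abs_le.1 (h i)).1, le_iSup_of_fintype α i]

lemma integrable_iSup_of_fintype {Z : Type*} [MeasurableSpace Z] {π : Measure Z}
    {f : Z → ι → ℝ} (hf : ∀ i, Integrable (fun z => f z i) π) :
    Integrable (fun z => ⨆ i, f z i) π := by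
  have hsum : Integrable (fun z => ∑ i, |f z i|) π :=
    integrable_finsetSum _ fun i _ => (hf i).abs
  refine hsum.mono' (AEMeasurable.iSup fun i => (hf i).aemeasurable).aestronglyMeasurable ?_
  refine Filter.Eventually.of_forall fun z => ?_
  have key : ∀ i, |f z i| ≤ ∑ i, |f z i| := fun i =>
    Finset.single_le_sum (f := fun i => |f z i|) (fun j _ => abs_nonneg _) (Finset.mem_univ i)
  have := abs_iSup_sub_iSup_le (α := f z) (β := fun _ => 0) (C := ∑ i, |f z i|)
    (by simpa using key)
  simpa using this

end FiniteMaximum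

/-! ### Symmetrization and contraction -/

section Contraction

variable {ι : Type*} [Fintype ι] [Nonempty ι]

/-- One step of symmetrization and contraction, without Rademacher signs: inside a maximum, the
centred variable `𝔼 F - F` may be replaced by `2 ℓ` as soon as `F` contracts `ℓ` and `ℓ` has a
symmetric law. The symmetrization is the exchange of a point with an independent copy of it. -/
lemma integral_iSup_sub_le_of_contraction {Z : Type*} [MeasurableSpace Z] (π : Measure Z)
    [IsProbabilityMeasure π] {F ℓ : Z → ι → ℝ} (hF : ∀ i, Integrable (fun z => F z i) π)
    (hℓ : ∀ i, Integrable (fun z => ℓ z i) π)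
    (hFℓ : ∀ z i j, F z i - F z j ≤ |ℓ z i - ℓ z j|) (β : ι → ℝ)
    (hsymm : ∫ z, (⨆ i, (β i - 2 * ℓ z i)) ∂π = ∫ z, (⨆ i, (β i + 2 * ℓ z i)) ∂π) :
    ∫ z, (⨆ i, (β i + ((∫ z', F z' i ∂π) - F z i))) ∂π ≤
      ∫ z, (⨆ i, (β i + 2 * ℓ z i)) ∂π := by
  set P : Z → ℝ := fun z => ⨆ i, (β i + 2 * ℓ z i) with hP
  set Q : Z → ℝ := fun z => ⨆ i, (β i - 2 * ℓ z i) with hQ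
  have hPi : Integrable P π :=
    integrable_iSup_of_fintype fun i => (integrable_const _).add ((hℓ i).const_mul 2)
  have hQi : Integrable Q π :=
    integrable_iSup_of_fintype fun i => (integrable_const _).sub ((hℓ i).const_mul 2)
  set A : Z × Z → ℝ := fun p => ⨆ i, (β i + (F p.2 i - F p.1 i)) with hA
  have hAi : Integrable A (π.prod π) := integrable_iSup_of_fintype fun i =>
    (integrable_const _).add (((hF i).comp_snd π).sub ((hF i).comp_fst π))
  have hsec : ∀ z, Integrable (fun z' => A (z, z')) π := fun z =>
    integrable_iSup_of_fintype fun i =>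
      (integrable_const (β i)).add ((hF i).sub (integrable_const (F z i)))
  have h1 : ∫ z, (⨆ i, (β i + ((∫ z', F z' i ∂π) - F z i))) ∂π ≤ ∫ p, A p ∂(π.prod π) := by
    rw [integral_prod _ hAi]
    refine integral_mono (integrable_iSup_of_fintype fun i =>
      (integrable_const _).add ((integrable_const _).sub (hF i))) hAi.integral_prod_left ?_
    intro z
    refine ciSup_le fun i => ?_
    have hdiff : Integrable (fun z' => F z' i - F z i) π := (hF i).sub (integrable_const (F z i))
    calc β i + ((∫ z', F z' i ∂π) - F z i) = ∫ z', (β i + (F z' i - F z i)) ∂π := by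
          rw [integral_add (integrable_const _) hdiff, integral_sub (hF i) (integrable_const _)]
          simp
      _ ≤ ∫ z', A (z, z') ∂π := by
          refine integral_mono ((integrable_const _).add hdiff) (hsec z) fun z' => ?_
          exact le_iSup_of_fintype (fun i => β i + (F z' i - F z i)) i
  have h2 : ∫ p, A p.swap ∂(π.prod π) = ∫ p, A p ∂(π.prod π) := integral_prod_swap A
  have hAs : Integrable (fun p : Z × Z => A p.swap) (π.prod π) := hAi.swap
  have hfst : Integrable (fun p : Z × Z => (P p.1 + Q p.1) / 2) (π.prod π) :=
    ((hPi.add hQi).div_const 2).comp_fst π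
  have hsnd : Integrable (fun p : Z × Z => (P p.2 + Q p.2) / 2) (π.prod π) :=
    ((hPi.add hQi).div_const 2).comp_snd π
  have h3 : ∫ p, (A p + A p.swap) ∂(π.prod π) ≤
      ∫ p, ((P p.1 + Q p.1) / 2 + (P p.2 + Q p.2) / 2) ∂(π.prod π) := by
    refine integral_mono (hAi.add hAs) (hfst.add hsnd) ?_
    rintro ⟨z, z'⟩
    -- In the two maxima the indices `i` and `j` may be chosen separately, and exchanging `i` and
    -- `j` changes the sign of `ℓ i - ℓ j`, so the absolute value costs nothing.
    have hPQ : ∀ z i j, β i + β j + 2 * |ℓ z i - ℓ z j| ≤ P z + Q z := by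
      intro z i j
      have e1 := le_iSup_of_fintype (fun i => β i + 2 * ℓ z i) i
      have e2 := le_iSup_of_fintype (fun i => β i + 2 * ℓ z i) j
      have e3 := le_iSup_of_fintype (fun i => β i - 2 * ℓ z i) i
      have e4 := le_iSup_of_fintype (fun i => β i - 2 * ℓ z i) j
      rcases abs_cases (ℓ z i - ℓ z j) with h | h <;> simp only [hP, hQ] <;> linarith
    have hsum : ∀ i j, (β i + (F z' i - F z i)) + (β j + (F z j - F z' j)) ≤
        (P z + Q z) / 2 + (P z' + Q z') / 2 := by
      intro i j
      have e1 := hFℓ z' i j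
      have e2 := hFℓ z j i
      rw [abs_sub_comm] at e2
      linarith [hPQ z i j, hPQ z' i j]
    simp only [hA, Prod.swap_prod_mk]
    rw [← le_sub_iff_add_le]
    refine ciSup_le fun i => ?_
    rw [le_sub_iff_add_le, ← le_sub_iff_add_le']
    refine ciSup_le fun j => ?_
    linarith [hsum i j]
  rw [integral_add hAi hAs, h2, integral_add hfst hsnd,
    integral_fun_fst (fun z => (P z + Q z) / 2), integral_fun_snd (fun z => (P z + Q z) / 2),
    integral_div, integral_add hPi hQi, hsymm] at h3
  simp only [probReal_univ, one_smul] at h3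
  linarith

end Contraction

/-! ### Maxima of finite Gaussian processes -/

section GaussianMaximum

variable {ι : Type*}
  {V : Type*} [NormedAddCommGroup V] [InnerProductSpace ℝ V] [FiniteDimensional ℝ V]
  [MeasurableSpace V]

/-- The expected maximum `𝔼 maxᵢ (βᵢ + s ⟨g, hᵢ⟩)` of a finite Gaussian process with offset `β`,
where `g` is a standard Gaussian vector. -/
noncomputable def gaussianMax (h : ι → V) (s : ℝ) (β : ι → ℝ) : ℝ :=
  ∫ g, (⨆ i, (β i + s * inner ℝ g (h i))) ∂(stdGaussian V)

lemma gaussianMax_offset_zero (h : ι → V) {s : ℝ} (hs : 0 ≤ s) :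
    gaussianMax h s 0 = s * ∫ g, (⨆ i, inner ℝ g (h i)) ∂(stdGaussian V) := by
  rw [gaussianMax, ← integral_const_mul]
  simp only [Pi.zero_apply, zero_add, Real.mul_iSup_of_nonneg hs]

variable [BorelSpace V]

lemma integrable_inner_stdGaussian (x : V) :
    Integrable (fun g => inner ℝ g x) (stdGaussian V) :=
  IsGaussian.integrable_fun_id.inner_const x

lemma abs_gaussianMax_sub_le [Fintype ι] [Nonempty ι] (h : ι → V) (s : ℝ) {β β' : ι → ℝ} {C : ℝ}
    (hC : ∀ i, |β i - β' i| ≤ C) : |gaussianMax h s β - gaussianMax h s β'| ≤ C := by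
  have hi : ∀ β : ι → ℝ, Integrable (fun g => ⨆ i, (β i + s * inner ℝ g (h i)))
      (stdGaussian V) := fun β => integrable_iSup_of_fintype fun i =>
    (integrable_const _).add ((integrable_inner_stdGaussian (h i)).const_mul s)
  rw [gaussianMax, gaussianMax, ← integral_sub (hi β) (hi β')]
  have := norm_integral_le_of_norm_le_const (μ := stdGaussian V) (C := C)
    (f := fun g => (⨆ i, (β i + s * inner ℝ g (h i))) - ⨆ i, (β' i + s * inner ℝ g (h i)))
    (Filter.Eventually.of_forall fun g => abs_iSup_sub_iSup_le fun i => by simpa using hC i)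
  simpa using this

lemma continuous_gaussianMax [Fintype ι] [Nonempty ι] (h : ι → V) (s : ℝ) :
    Continuous (gaussianMax h s) := by
  refine (LipschitzWith.of_dist_le_mul (K := 1) fun β β' => ?_).continuous
  rw [NNReal.coe_one, one_mul, Real.dist_eq]
  refine abs_gaussianMax_sub_le h s fun i => ?_
  rw [← Real.dist_eq]
  exact dist_le_pi_dist β β' i

lemma gaussianMax_zero (h : ι → V) (β : ι → ℝ) : gaussianMax h 0 β = ⨆ i, β i := by
  simp [gaussianMax]

lemma map_neg_stdGaussian : (stdGaussian V).map (fun g => -g) = stdGaussian V :=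
  stdGaussian_map (LinearIsometryEquiv.neg ℝ (E := V))

lemma map_linearCombination_stdGaussian (s u : ℝ) :
    ((stdGaussian V).prod (stdGaussian V)).map (fun p => s • p.1 + u • p.2) =
      (stdGaussian V).map (fun g => √(s ^ 2 + u ^ 2) • g) := by
  have hconv : ((stdGaussian V).prod (stdGaussian V)).map (fun p => s • p.1 + u • p.2) =
      ((stdGaussian V).map (fun g => s • g)) ∗ ((stdGaussian V).map (fun g => u • g)) := by
    rw [Measure.conv, Measure.map_prod_map _ _ (by fun_prop) (by fun_prop),
      Measure.map_map (by fun_prop) (by fun_prop)]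
    rfl
  have : IsProbabilityMeasure ((stdGaussian V).map (fun g => s • g)) :=
    Measure.isProbabilityMeasure_map (by fun_prop)
  have : IsProbabilityMeasure ((stdGaussian V).map (fun g => u • g)) :=
    Measure.isProbabilityMeasure_map (by fun_prop)
  have : IsProbabilityMeasure ((stdGaussian V).map (fun g => √(s ^ 2 + u ^ 2) • g)) :=
    Measure.isProbabilityMeasure_map (by fun_prop)
  rw [hconv]
  apply Measure.ext_of_charFun
  ext x
  rw [charFun_conv, charFun_map_smul, charFun_map_smul, charFun_map_smul, charFun_stdGaussian,
    charFun_stdGaussian, charFun_stdGaussian, ← Complex.exp_add]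
  congr 1
  simp only [norm_smul, Real.norm_eq_abs]
  norm_cast
  rw [mul_pow, mul_pow, mul_pow, sq_abs, sq_abs, sq_abs, Real.sq_sqrt (by positivity)]
  ring

/-- Adding an independent Gaussian process adds up the squares of the standard deviations. -/
lemma integral_gaussianMax_add [Fintype ι] [Nonempty ι] (h : ι → V) (s u : ℝ) (β : ι → ℝ) :
    ∫ a, gaussianMax h s (fun i => β i + u * inner ℝ a (h i)) ∂(stdGaussian V) =
      gaussianMax h (√(u ^ 2 + s ^ 2)) β := by
  have hi : Integrable (fun p : V × V => ⨆ i, (β i + u * inner ℝ p.1 (h i) +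
      s * inner ℝ p.2 (h i))) ((stdGaussian V).prod (stdGaussian V)) :=
    integrable_iSup_of_fintype fun i => ((integrable_const _).add
      (((integrable_inner_stdGaussian (h i)).const_mul u).comp_fst _)).add
        (((integrable_inner_stdGaussian (h i)).const_mul s).comp_snd _)
  have hm : Measurable (fun g : V => ⨆ i, (β i + inner ℝ g (h i))) :=
    Measurable.iSup fun i => by fun_prop
  simp only [gaussianMax]
  rw [← integral_prod _ hi]
  calc ∫ p : V × V, (⨆ i, (β i + u * inner ℝ p.1 (h i) + s * inner ℝ p.2 (h i)))
        ∂((stdGaussian V).prod (stdGaussian V))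
      = ∫ p : V × V, (⨆ i, (β i + inner ℝ (u • p.1 + s • p.2) (h i)))
        ∂((stdGaussian V).prod (stdGaussian V)) := by
        simp only [inner_add_left, real_inner_smul_left, add_assoc]
    _ = ∫ g, (⨆ i, (β i + inner ℝ g (h i))) ∂(((stdGaussian V).prod (stdGaussian V)).map
          (fun p => u • p.1 + s • p.2)) :=
        (integral_map (by fun_prop) hm.aestronglyMeasurable).symm
    _ = _ := by
        rw [map_linearCombination_stdGaussian,
          integral_map (by fun_prop) hm.aestronglyMeasurable]
        simp only [real_inner_smul_left]

end GaussianMaximum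

/-! ### Uniform deviation over finite index sets -/

section UniformDeviation

variable {ι : Type*} [Fintype ι] [Nonempty ι]
  {V : Type*} [NormedAddCommGroup V] [InnerProductSpace ℝ V] [FiniteDimensional ℝ V]
  [MeasurableSpace V] [BorelSpace V] {Z : Type*} [MeasurableSpace Z]

/-- A summand `𝔼 F - F` inside an expected Gaussian maximum may be replaced by an independent
Gaussian summand of standard deviation `2`. -/
lemma integral_gaussianMax_sub_le (π : Measure Z) [IsProbabilityMeasure π] {A : Z → V}
    (hA : Measurable A) (hAπ : π.map A = stdGaussian V) (h : ι → V) {F : Z → ι → ℝ}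
    (hF : ∀ i, Integrable (fun z => F z i) π)
    (hFA : ∀ z i j, F z i - F z j ≤ |inner ℝ (A z) (h i) - inner ℝ (A z) (h j)|)
    (s : ℝ) (β : ι → ℝ) :
    ∫ z, gaussianMax h s (fun i => β i + ((∫ z', F z' i ∂π) - F z i)) ∂π ≤
      gaussianMax h (√(2 ^ 2 + s ^ 2)) β := by
  have hA_int : ∀ x, Integrable (fun z => inner ℝ (A z) x) π := fun x =>
    Integrable.comp_measurable (f := A) (g := fun g => inner ℝ g x)
      (hAπ ▸ integrable_inner_stdGaussian x) hA
  have hg : ∀ i, Integrable (fun g => s * inner ℝ g (h i)) (stdGaussian V) := fun i =>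
    (integrable_inner_stdGaussian (h i)).const_mul s
  have hi₁ : Integrable (fun p : Z × V => ⨆ i, (β i + ((∫ z', F z' i ∂π) - F p.1 i) +
      s * inner ℝ p.2 (h i))) (π.prod (stdGaussian V)) :=
    integrable_iSup_of_fintype fun i => ((integrable_const _).add
      (((integrable_const (∫ z', F z' i ∂π)).sub (hF i)).comp_fst _)).add ((hg i).comp_snd _)
  have hi₂ : Integrable (fun p : Z × V => ⨆ i, (β i + 2 * inner ℝ (A p.1) (h i) +
      s * inner ℝ p.2 (h i))) (π.prod (stdGaussian V)) :=
    integrable_iSup_of_fintype fun i => ((integrable_const _).add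
      (((hA_int (h i)).const_mul 2).comp_fst _)).add ((hg i).comp_snd _)
  have hsymm : ∀ β : ι → ℝ, ∫ z, (⨆ i, (β i - 2 * inner ℝ (A z) (h i))) ∂π =
      ∫ z, (⨆ i, (β i + 2 * inner ℝ (A z) (h i))) ∂π := by
    intro β
    have hm₁ : Measurable (fun g : V => ⨆ i, (β i - 2 * inner ℝ g (h i))) :=
      Measurable.iSup fun i => by fun_prop
    have hm₂ : Measurable (fun g : V => ⨆ i, (β i + 2 * inner ℝ g (h i))) :=
      Measurable.iSup fun i => by fun_prop
    rw [← integral_map (φ := A) hA.aemeasurable hm₁.aestronglyMeasurable,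
      ← integral_map (φ := A) hA.aemeasurable hm₂.aestronglyMeasurable, hAπ,
      ← map_neg_stdGaussian, integral_map (by fun_prop) hm₁.aestronglyMeasurable,
      map_neg_stdGaussian]
    simp only [inner_neg_left, mul_neg, sub_neg_eq_add]
  have hm : Measurable (fun a : V => gaussianMax h s (fun i => β i + 2 * inner ℝ a (h i))) :=
    (continuous_gaussianMax h s).measurable.comp (measurable_pi_lambda _ fun i => by fun_prop)
  calc ∫ z, gaussianMax h s (fun i => β i + ((∫ z', F z' i ∂π) - F z i)) ∂π
      = ∫ g, ∫ z, (⨆ i, (β i + ((∫ z', F z' i ∂π) - F z i) + s * inner ℝ g (h i))) ∂π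
          ∂(stdGaussian V) := integral_integral_swap hi₁
    _ ≤ ∫ g, ∫ z, (⨆ i, (β i + 2 * inner ℝ (A z) (h i) + s * inner ℝ g (h i))) ∂π
          ∂(stdGaussian V) := by
        refine integral_mono hi₁.integral_prod_right hi₂.integral_prod_right fun g => ?_
        have := integral_iSup_sub_le_of_contraction π hF (fun i => hA_int (h i)) hFA
          (fun i => β i + s * inner ℝ g (h i)) (hsymm _)
        simpa only [add_right_comm] using this
    _ = ∫ z, gaussianMax h s (fun i => β i + 2 * inner ℝ (A z) (h i)) ∂π :=
        (integral_integral_swap hi₂).symm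
    _ = ∫ a, gaussianMax h s (fun i => β i + 2 * inner ℝ a (h i)) ∂(stdGaussian V) := by
        rw [← hAπ, integral_map hA.aemeasurable hm.aestronglyMeasurable]
    _ = _ := integral_gaussianMax_add h s 2 β

/-- Exponential form of the replacement step: Hoeffding's lemma costs a factor `exp (b² / 2)`,
because the maximum varies over an interval of length `2` when `F` is bounded by `1`. -/
lemma lintegral_exp_gaussianMax_sub_le (π : Measure Z) [IsProbabilityMeasure π] {A : Z → V}
    (hA : Measurable A) (hAπ : π.map A = stdGaussian V) (h : ι → V) {F : Z → ι → ℝ}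
    (hF : ∀ i, Measurable (fun z => F z i)) (hF_le : ∀ z i, |F z i| ≤ 1)
    (hFA : ∀ z i j, F z i - F z j ≤ |inner ℝ (A z) (h i) - inner ℝ (A z) (h j)|)
    {b : ℝ} (hb : 0 ≤ b) (s : ℝ) (β : ι → ℝ) :
    ∫⁻ z, ENNReal.ofReal (Real.exp
        (b * gaussianMax h s (fun i => β i + ((∫ z', F z' i ∂π) - F z i)))) ∂π ≤
      ENNReal.ofReal (Real.exp (b ^ 2 / 2)) *
        ENNReal.ofReal (Real.exp (b * gaussianMax h (√(2 ^ 2 + s ^ 2)) β)) := by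
  have hFi : ∀ i, Integrable (fun z => F z i) π := fun i =>
    Integrable.of_bound (hF i).aestronglyMeasurable 1
      (Filter.Eventually.of_forall fun z => by simpa using hF_le z i)
  set X : Z → ℝ := fun z => gaussianMax h s (fun i => β i + ((∫ z', F z' i ∂π) - F z i)) with hX
  set d : ℝ := gaussianMax h s (fun i => β i + ∫ z', F z' i ∂π)
  have hXm : Measurable X := (continuous_gaussianMax h s).measurable.comp
    (measurable_pi_lambda _ fun i => by have := hF i; fun_prop)
  have hXmem : ∀ z, X z ∈ Set.Icc (d - 1) (d + 1) := by
    intro z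
    have := abs_le.1 (abs_gaussianMax_sub_le h s (C := 1)
      (β := fun i => β i + ((∫ z', F z' i ∂π) - F z i))
      (β' := fun i => β i + ∫ z', F z' i ∂π) fun i => by
        rw [add_sub_add_left_eq_sub, sub_sub_cancel_left, abs_neg]; exact hF_le z i)
    constructor <;> linarith [this.1, this.2]
  have hsub := hasSubgaussianMGF_of_mem_Icc (μ := π) hXm.aemeasurable
    (Filter.Eventually.of_forall hXmem)
  have hmgf := hsub.mgf_le b
  have hpar : (((‖d + 1 - (d - 1)‖₊ / 2) ^ 2 : NNReal) : ℝ) = 1 := by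
    have : d + 1 - (d - 1) = 2 := by ring
    rw [this]; simp
  rw [hpar, one_mul] at hmgf
  have hmean : π[X] ≤ gaussianMax h (√(2 ^ 2 + s ^ 2)) β :=
    integral_gaussianMax_sub_le π hA hAπ h hFi hFA s β
  have hint : Integrable (fun z => Real.exp (b * X z)) π :=
    integrable_exp_mul_of_mem_Icc hXm.aemeasurable (Filter.Eventually.of_forall hXmem)
  rw [← ofReal_integral_eq_lintegral_ofReal hint
    (Filter.Eventually.of_forall fun z => (Real.exp_pos _).le),
    ← ENNReal.ofReal_mul (Real.exp_pos _).le]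
  refine ENNReal.ofReal_le_ofReal ?_
  calc ∫ z, Real.exp (b * X z) ∂π
      = mgf (fun z => X z - π[X]) π b * Real.exp (b * π[X]) := by
        rw [mgf, ← integral_mul_const]
        refine integral_congr_ae (Filter.Eventually.of_forall fun z => ?_)
        simp only [← Real.exp_add]
        congr 1; ring
    _ ≤ Real.exp (b ^ 2 / 2) * Real.exp (b * gaussianMax h (√(2 ^ 2 + s ^ 2)) β) := by
        gcongr

/-- Replacing the summands one at a time: the `m` contracted summands turn into a Gaussian
summand of variance `4 m`. -/
lemma lintegral_exp_gaussianMax_sum_le (π : Measure Z) [IsProbabilityMeasure π] {A : Z → V}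
    (hA : Measurable A) (hAπ : π.map A = stdGaussian V) (h : ι → V) {F : Z → ι → ℝ}
    (hF : ∀ i, Measurable (fun z => F z i)) (hF_le : ∀ z i, |F z i| ≤ 1)
    (hFA : ∀ z i j, F z i - F z j ≤ |inner ℝ (A z) (h i) - inner ℝ (A z) (h j)|)
    {b : ℝ} (hb : 0 ≤ b) (m : ℕ) (k : ℝ) (hk : 0 ≤ k) (β : ι → ℝ) :
    ∫⁻ x : Fin m → Z, ENNReal.ofReal (Real.exp (b * gaussianMax h (2 * √k)
        (fun i => β i + ∑ j, ((∫ z', F z' i ∂π) - F (x j) i)))) ∂(Measure.pi fun _ => π) ≤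
      ENNReal.ofReal (Real.exp (m * (b ^ 2 / 2) + b * gaussianMax h (2 * √(k + m)) β)) := by
  induction m generalizing k β with
  | zero => simp
  | succ m ih =>
    have hsq : √(2 ^ 2 + (2 * √k) ^ 2) = 2 * √(k + 1) := by
      rw [mul_pow, Real.sq_sqrt hk,
        show (2 : ℝ) ^ 2 + 2 ^ 2 * k = 2 ^ 2 * (k + 1) by ring,
        Real.sqrt_mul (by positivity), Real.sqrt_sq (by norm_num)]
    set G : Z × (Fin m → Z) → ℝ≥0∞ := fun p => ENNReal.ofReal (Real.exp (b *
      gaussianMax h (2 * √k) (fun i => β i + (∑ j, ((∫ z', F z' i ∂π) - F (p.2 j) i)) +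
        ((∫ z', F z' i ∂π) - F p.1 i)))) with hG
    have hGm : Measurable G := by
      refine ENNReal.measurable_ofReal.comp (Real.measurable_exp.comp (Measurable.const_mul ?_ b))
      refine (continuous_gaussianMax h _).measurable.comp (measurable_pi_lambda _ fun i => ?_)
      have hFi := hF i
      refine Measurable.add (measurable_const.add (Finset.measurable_sum _ fun j _ => ?_)) ?_
      · exact measurable_const.sub (hFi.comp ((measurable_pi_apply j).comp measurable_snd))
      · exact measurable_const.sub (hFi.comp measurable_fst)
    have hmp := measurePreserving_piFinSuccAbove (fun _ : Fin (m + 1) => π) 0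
    calc _ = ∫⁻ x : Fin (m + 1) → Z, G (MeasurableEquiv.piFinSuccAbove (fun _ => Z) 0 x)
          ∂(Measure.pi fun _ => π) := by
          refine lintegral_congr fun x => ?_
          simp only [hG, Fin.sum_univ_succ, MeasurableEquiv.piFinSuccAbove_apply]
          congr 4
          ext i
          simp [Fin.tail]
          ring
      _ = ∫⁻ p, G p ∂(π.prod (Measure.pi fun _ => π)) := hmp.lintegral_comp hGm
      _ = ∫⁻ x : Fin m → Z, ∫⁻ z, G (z, x) ∂π ∂(Measure.pi fun _ => π) :=
          lintegral_prod_symm' _ hGm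
      _ ≤ ∫⁻ x : Fin m → Z, ENNReal.ofReal (Real.exp (b ^ 2 / 2)) *
            ENNReal.ofReal (Real.exp (b * gaussianMax h (2 * √(k + 1))
              (fun i => β i + ∑ j, ((∫ z', F z' i ∂π) - F (x j) i))))
            ∂(Measure.pi fun _ => π) := by
          refine lintegral_mono fun x => ?_
          have hstep := lintegral_exp_gaussianMax_sub_le π hA hAπ h hF hF_le hFA hb (2 * √k)
            (fun i => β i + ∑ j, ((∫ z', F z' i ∂π) - F (x j) i))
          rw [hsq] at hstep
          exact hstep
      _ ≤ ENNReal.ofReal (Real.exp (b ^ 2 / 2)) * ENNReal.ofReal (Real.exp (m * (b ^ 2 / 2) +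
            b * gaussianMax h (2 * √(k + 1 + m)) β)) := by
          rw [lintegral_const_mul' _ _ ENNReal.ofReal_ne_top]
          exact mul_le_mul' le_rfl (ih (k + 1) (by positivity) β)
      _ = ENNReal.ofReal (Real.exp ((m + 1 : ℕ) * (b ^ 2 / 2) +
            b * gaussianMax h (2 * √(k + (m + 1 : ℕ))) β)) := by
          rw [← ENNReal.ofReal_mul (Real.exp_pos _).le, ← Real.exp_add, Nat.cast_succ,
            show k + 1 + (m : ℝ) = k + (m + 1) by ring]
          congr 2
          ring

/-- Chernoff's bound for the largest of finitely many sums of contracted summands. The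
exponential parameter `b` is left free. -/
lemma measure_exists_le_sum_sub_le (π : Measure Z) [IsProbabilityMeasure π] {A : Z → V}
    (hA : Measurable A) (hAπ : π.map A = stdGaussian V) (h : ι → V) {F : Z → ι → ℝ}
    (hF : ∀ i, Measurable (fun z => F z i)) (hF_le : ∀ z i, |F z i| ≤ 1)
    (hFA : ∀ z i j, F z i - F z j ≤ |inner ℝ (A z) (h i) - inner ℝ (A z) (h j)|)
    {b : ℝ} (hb : 0 ≤ b) (m : ℕ) (u w : ℝ)
    (hw : ∫ g, (⨆ i, inner ℝ g (h i)) ∂(stdGaussian V) ≤ w) :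
    (Measure.pi fun _ : Fin m => π) {x | ∃ i, u ≤ ∑ j, ((∫ z', F z' i ∂π) - F (x j) i)} ≤
      ENNReal.ofReal (Real.exp (m * (b ^ 2 / 2) + b * (2 * √m * w) - b * u)) := by
  have hmain := lintegral_exp_gaussianMax_sum_le π hA hAπ h hF hF_le hFA hb m 0 le_rfl 0
  have hsub : {x : Fin m → Z | ∃ i, u ≤ ∑ j, ((∫ z', F z' i ∂π) - F (x j) i)} ⊆
      {x | ENNReal.ofReal (Real.exp (b * u)) ≤ ENNReal.ofReal (Real.exp (b * gaussianMax h
        (2 * √0) (fun i => (0 : ι → ℝ) i + ∑ j, ((∫ z', F z' i ∂π) - F (x j) i))))} := by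
    rintro x ⟨i, hi⟩
    refine ENNReal.ofReal_le_ofReal (Real.exp_le_exp.2 (mul_le_mul_of_nonneg_left ?_ hb))
    rw [Real.sqrt_zero, mul_zero, gaussianMax_zero]
    refine le_trans ?_ (le_iSup_of_fintype _ i)
    simpa using hi
  refine (measure_mono hsub).trans ?_
  refine (meas_ge_le_lintegral_div ?_ (by simp [Real.exp_pos]) ENNReal.ofReal_ne_top).trans ?_
  · refine Measurable.aemeasurable (ENNReal.measurable_ofReal.comp (Real.measurable_exp.comp
      (Measurable.const_mul ?_ b)))
    refine (continuous_gaussianMax h _).measurable.comp (measurable_pi_lambda _ fun i => ?_)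
    exact measurable_const.add (Finset.measurable_sum _ fun j _ =>
      measurable_const.sub ((hF i).comp (measurable_pi_apply j)))
  · refine (ENNReal.div_le_div_right hmain _).trans ?_
    rw [← ENNReal.ofReal_div_of_pos (Real.exp_pos _), ← Real.exp_sub, zero_add,
      gaussianMax_offset_zero h (by positivity)]
    gcongr

end UniformDeviation

/-! ### The local mean width -/

section LocalMeanWidth

/-- The expected Gaussian maximum over finitely many directions is bounded by the local mean width.
The supremum that defines the latter is a Lipschitz function of the Gaussian vector, so its integral
is not a junk value, whatever the set `L` is. -/
lemma integral_iSup_inner_le_localMeanWidth {n : ℕ} {t : ℝ} (ht : 0 < t)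
    {L : Set (EuclideanSpace ℝ (Fin n))} {ι : Type*} [Fintype ι] [Nonempty ι]
    {h : ι → EuclideanSpace ℝ (Fin n)} (h_norm : ∀ i, ‖h i‖ ≤ 1) (hL : ∀ i, t • h i ∈ L) :
    ∫ g, (⨆ i, inner ℝ g (h i)) ∂(stdGaussian (EuclideanSpace ℝ (Fin n))) ≤
      localMeanWidth t L / t := by
  set S := L ∩ Metric.closedBall (0 : EuclideanSpace ℝ (Fin n)) t
  have hmem : ∀ i, t • h i ∈ S := fun i => ⟨hL i, by
    rw [mem_closedBall_zero_iff, norm_smul, Real.norm_of_nonneg ht.le]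
    exact mul_le_of_le_one_right ht.le (h_norm i)⟩
  have : Nonempty S := ⟨⟨_, hmem (Classical.arbitrary ι)⟩⟩
  have hnorm : ∀ x : S, ‖(x : EuclideanSpace ℝ (Fin n))‖ ≤ t := fun x =>
    mem_closedBall_zero_iff.1 x.2.2
  have hbdd : ∀ g : EuclideanSpace ℝ (Fin n),
      BddAbove (Set.range fun x : S => inner ℝ g (x : EuclideanSpace ℝ (Fin n))) := by
    intro g
    refine ⟨‖g‖ * t, ?_⟩
    rintro _ ⟨x, rfl⟩
    exact (real_inner_le_norm _ _).trans (by gcongr; exact hnorm x)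
  set f : EuclideanSpace ℝ (Fin n) → ℝ := fun g =>
    ⨆ x : S, inner ℝ g (x : EuclideanSpace ℝ (Fin n)) with hf
  have hle : ∀ g g', f g ≤ f g' + t * ‖g - g'‖ := by
    intro g g'
    refine ciSup_le fun x => ?_
    have h1 : inner ℝ g (x : EuclideanSpace ℝ (Fin n)) =
        inner ℝ g' (x : EuclideanSpace ℝ (Fin n)) +
          inner ℝ (g - g') (x : EuclideanSpace ℝ (Fin n)) := by
      rw [inner_sub_left]; ring
    have h2 : inner ℝ (g - g') (x : EuclideanSpace ℝ (Fin n)) ≤ t * ‖g - g'‖ := by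
      rw [mul_comm]
      exact (real_inner_le_norm _ _).trans (by gcongr; exact hnorm x)
    have h3 : inner ℝ g' (x : EuclideanSpace ℝ (Fin n)) ≤ f g' := le_ciSup (hbdd g') x
    linarith
  have hcont : Continuous f := by
    refine (LipschitzWith.of_le_add_mul t.toNNReal fun g g' => ?_).continuous
    rw [Real.coe_toNNReal t ht.le, dist_eq_norm]
    exact hle g g'
  have hf0 : f 0 = 0 := by simp [hf]
  have hfint : Integrable f (stdGaussian (EuclideanSpace ℝ (Fin n))) := by
    have hid : Integrable (fun g : EuclideanSpace ℝ (Fin n) => g)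
      (stdGaussian (EuclideanSpace ℝ (Fin n))) := IsGaussian.integrable_fun_id
    refine (hid.norm.const_mul t).mono' hcont.aestronglyMeasurable
      (Filter.Eventually.of_forall fun g => ?_)
    have h1 := hle g 0
    have h2 := hle 0 g
    rw [hf0, sub_zero] at h1
    rw [hf0, zero_sub, norm_neg] at h2
    rw [Real.norm_eq_abs, abs_le]
    constructor <;> linarith
  rw [le_div_iff₀ ht, mul_comm, ← integral_const_mul]
  refine integral_mono ((integrable_iSup_of_fintype fun i =>
    integrable_inner_stdGaussian (h i)).const_mul t) hfint fun g => ?_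
  simp only [Real.mul_iSup_of_nonneg ht.le]
  refine ciSup_le fun i => ?_
  rw [← real_inner_smul_right]
  exact le_ciSup (hbdd g) ⟨_, hmem i⟩

end LocalMeanWidth

/-! ### Uniform deviation over arbitrary index sets -/

section UniformDeviationSet

variable {V : Type*} [NormedAddCommGroup V] [InnerProductSpace ℝ V] [FiniteDimensional ℝ V]
  [MeasurableSpace V] [BorelSpace V] {Z : Type*} [MeasurableSpace Z]

/-- The deviation inequality over an arbitrary index set `T`. The exceptional set is measurable
because it only refers to a countable dense subset of `T`. -/
lemma exists_measurableSet_sum_sub_le (π : Measure Z) [IsProbabilityMeasure π] {A : Z → V}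
    (hA : Measurable A) (hAπ : π.map A = stdGaussian V) {F : Z → V → ℝ}
    (hF : ∀ v, Measurable (fun z => F z v)) (hF_cont : ∀ z, Continuous (F z))
    (hF_le : ∀ z v, |F z v| ≤ 1)
    (hFA : ∀ z v v', F z v - F z v' ≤ |inner ℝ (A z) v - inner ℝ (A z) v'|)
    {T : Set V} {r : ℝ} (hr : ∀ v ∈ T, ∫ z, F z v ∂π = r)
    {b : ℝ} (hb : 0 ≤ b) (m : ℕ) (u : ℝ) {w : ℝ}
    (hw : ∀ (k : ℕ) (h : Fin (k + 1) → V), (∀ i, h i ∈ T) →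
      ∫ g, (⨆ i, inner ℝ g (h i)) ∂(stdGaussian V) ≤ w) :
    ∃ B : Set (Fin m → Z), MeasurableSet B ∧
      (Measure.pi fun _ => π) B ≤
        ENNReal.ofReal (Real.exp (m * (b ^ 2 / 2) + b * (2 * √m * w) - b * u)) ∧
      ∀ x ∉ B, ∀ v ∈ T, ∑ j, (r - F (x j) v) ≤ u := by
  rcases T.eq_empty_or_nonempty with rfl | hT
  · exact ⟨∅, MeasurableSet.empty, by simp, by simp⟩
  have := hT.to_subtype
  set d : ℕ → T := TopologicalSpace.denseSeq T
  set D : ℕ → Set (Fin m → Z) := fun k => {x | ∃ i : Fin (k + 1), u ≤ ∑ j, (r - F (x j) (d i))}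
    with hD
  refine ⟨⋃ k, D k, ?_, ?_, ?_⟩
  · refine MeasurableSet.iUnion fun k => ?_
    simp only [hD, Set.ofPred_exists]
    refine MeasurableSet.iUnion fun i => measurableSet_le measurable_const ?_
    exact Finset.measurable_sum _ fun j _ =>
      measurable_const.sub ((hF _).comp (measurable_pi_apply j))
  · have hmono : Monotone D := by
      intro k l hkl x
      rintro ⟨i, hi⟩
      exact ⟨⟨i, by omega⟩, hi⟩
    rw [hmono.measure_iUnion]
    refine iSup_le fun k => ?_
    have := measure_exists_le_sum_sub_le π hA hAπ (fun i : Fin (k + 1) => (d i : V))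
      (F := fun z i => F z (d i)) (fun i => hF _) (fun z i => hF_le z _)
      (fun z i j => hFA z _ _) hb m u w (hw k _ fun i => (d i).2)
    simpa only [hr _ (d _).2] using this
  · intro x hx v hv
    have hclosed : IsClosed {v : T | ∑ j, (r - F (x j) v) ≤ u} :=
      isClosed_le (continuous_finsetSum _ fun j _ =>
        continuous_const.sub ((hF_cont _).comp continuous_subtype_val)) continuous_const
    have hsub : Set.range d ⊆ {v : T | ∑ j, (r - F (x j) v) ≤ u} := by
      rintro _ ⟨k, rfl⟩
      by_contra hk
      exact hx (Set.mem_iUnion.2 ⟨k, Fin.last k, (not_le.1 hk).le⟩)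
    have := hclosed.closure_subset_iff.2 hsub
    rw [(TopologicalSpace.denseRange_denseSeq T).closure_range] at this
    exact this (Set.mem_univ (⟨v, hv⟩ : T))

end UniformDeviationSet

/-! ### The Taylor error -/

section TaylorError

lemma ConvexOn.add_mul_sub_le_of_hasDerivAt {S : Set ℝ} {f : ℝ → ℝ} (hf : ConvexOn ℝ S f)
    {x y f' : ℝ} (hx : x ∈ S) (hy : y ∈ S) (hf' : HasDerivAt f f' x) :
    f x + f' * (y - x) ≤ f y := by
  rcases lt_trichotomy x y with h | rfl | h
  · have := hf.le_slope_of_hasDerivAt hx hy h hf'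
    rw [slope_def_field, le_div_iff₀ (sub_pos.2 h)] at this
    linarith
  · simp
  · have := hf.slope_le_of_hasDerivAt hy hx h hf'
    rw [slope_def_field, div_le_iff₀ (sub_pos.2 h)] at this
    linarith

/-- A function whose second derivative is at least `c` between `x` and `y` differs from
`v ↦ c / 2 * v ^ 2` by a convex function there, which lies above its tangent at `x`. -/
lemma mul_sq_le_taylor_remainder {f : ℝ → ℝ} (hf : ContDiff ℝ 2 f) {c x y : ℝ}
    (hc : ∀ v ∈ Set.uIcc x y, c ≤ iteratedDeriv 2 f v) :
    c / 2 * (y - x) ^ 2 ≤ f y - f x - deriv f x * (y - x) := by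
  have hd : Differentiable ℝ f := hf.differentiable (by norm_num)
  have hd' : Differentiable ℝ (deriv f) := by
    have := hf.differentiable_iteratedDeriv 1 (by norm_num)
    rwa [iteratedDeriv_one] at this
  have hder : ∀ v, HasDerivAt (fun v => f v - c / 2 * v ^ 2) (deriv f v - c * v) v := by
    intro v
    have h2 := ((hasDerivAt_id v).pow 2).const_mul (c / 2)
    refine ((hd v).hasDerivAt.sub h2).congr_deriv ?_
    simp; ring
  have hderiv : deriv (fun v => f v - c / 2 * v ^ 2) = fun v => deriv f v - c * v :=
    funext fun v => (hder v).deriv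
  have hder2 : ∀ v, HasDerivAt (fun v => deriv f v - c * v) (iteratedDeriv 2 f v - c) v := by
    intro v
    rw [iteratedDeriv_succ, iteratedDeriv_one]
    simpa using (hd' v).hasDerivAt.fun_sub ((hasDerivAt_id' v).const_mul c)
  have hconv : ConvexOn ℝ (Set.uIcc x y) (fun v => f v - c / 2 * v ^ 2) := by
    refine convexOn_of_deriv2_nonneg' (convex_uIcc x y)
      (fun v _ => (hder v).differentiableAt.differentiableWithinAt) ?_ fun v hv => ?_
    · rw [hderiv]
      exact fun v _ => (hder2 v).differentiableAt.differentiableWithinAt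
    · rw [Function.iterate_succ, Function.iterate_one, Function.comp_apply, hderiv,
        (hder2 v).deriv]
      exact sub_nonneg.2 (hc v hv)
  have := hconv.add_mul_sub_le_of_hasDerivAt Set.left_mem_uIcc Set.right_mem_uIcc (hder x)
  linarith

lemma taylorError_eq_sum {n m : ℕ} {Y : Set ℝ} {L : ℝ → Y → ℝ}
    (hL : ∀ y, Differentiable ℝ (fun v => L v y))
    (a : Fin m → EuclideanSpace ℝ (Fin n)) (y : Fin m → Y) (x z : EuclideanSpace ℝ (Fin n)) :
    taylorError L a y x z = (1 / (m : ℝ)) * ∑ i, (L (inner ℝ (a i) x) (y i) -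
      L (inner ℝ (a i) z) (y i) - deriv (fun v => L v (y i)) (inner ℝ (a i) z) *
        (inner ℝ (a i) x - inner ℝ (a i) z)) := by
  have hterm : ∀ i, HasFDerivAt (fun x => L (inner ℝ (a i) x) (y i))
      (deriv (fun v => L v (y i)) (inner ℝ (a i) z) • innerSL ℝ (a i)) z := fun i =>
    ((hL (y i)) (inner ℝ (a i) z)).hasDerivAt.comp_hasFDerivAt z
      (innerSL ℝ (a i)).hasFDerivAt
  have hsum : HasFDerivAt (empiricalLoss L a y) ((1 / (m : ℝ)) •
      ∑ i, deriv (fun v => L v (y i)) (inner ℝ (a i) z) • innerSL ℝ (a i)) z :=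
    (HasFDerivAt.fun_sum fun i _ => hterm i).const_mul _
  rw [taylorError, gradient, InnerProductSpace.toDual_symm_apply, hsum.fderiv, empiricalLoss,
    empiricalLoss]
  simp only [smul_apply, sum_apply, smul_eq_mul,
    innerSL_apply_apply, Finset.sum_sub_distrib, inner_sub_right]
  ring

end TaylorError

/-! ### The tent function -/

section Tent

/-- The tent function of height `1` over the interval `[1, 3]`: a `1`-Lipschitz lower bound
for the indicator of the interval `[1, 3]`. -/
noncomputable def tent (s : ℝ) : ℝ := max 0 (1 - |s - 2|)

lemma tent_nonneg (s : ℝ) : 0 ≤ tent s := le_max_left _ _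

lemma tent_le_one (s : ℝ) : tent s ≤ 1 :=
  max_le zero_le_one (by linarith [abs_nonneg (s - 2)])

lemma continuous_tent : Continuous tent := by
  unfold tent; fun_prop

lemma tent_sub_le (s s' : ℝ) : tent s - tent s' ≤ |s - s'| := by
  rw [sub_le_iff_le_add]
  refine max_le (add_nonneg (abs_nonneg _) (tent_nonneg _)) ?_
  have h1 : 1 - |s' - 2| ≤ tent s' := le_max_right _ _
  have h2 := abs_sub_le s' s 2
  rw [abs_sub_comm s' s] at h2
  linarith

lemma mem_Ioo_of_tent_pos {s : ℝ} (hs : 0 < tent s) : 1 < s ∧ s < 3 := by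
  rcases lt_max_iff.1 hs with h | h
  · exact absurd h (lt_irrefl _)
  · have := abs_lt.1 (sub_pos.1 h)
    constructor <;> linarith [this.1, this.2]

lemma integrable_tent : Integrable tent (gaussianReal 0 1) :=
  Integrable.of_bound continuous_tent.aestronglyMeasurable 1
    (Filter.Eventually.of_forall fun s => by
      rw [Real.norm_of_nonneg (tent_nonneg s)]; exact tent_le_one s)

lemma integral_tent_pos : 0 < ∫ s, tent s ∂(gaussianReal 0 1) := by
  rw [integral_pos_iff_support_of_nonneg tent_nonneg integrable_tent, pos_iff_ne_zero]
  intro h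
  -- Lebesgue measure is absolutely continuous with respect to the Gaussian measure.
  have h0 := gaussianReal_absolutelyContinuous' 0 one_ne_zero h
  have hopen : IsOpen (Function.support tent) := continuous_tent.isOpen_support
  have h2 : (2 : ℝ) ∈ Function.support tent := by simp [tent]
  exact (hopen.measure_pos volume ⟨2, h2⟩).ne' h0

end Tent

/-! ### Marginals and tails of the standard Gaussian -/

section StandardGaussian

lemma map_inner_stdGaussian {V : Type*} [NormedAddCommGroup V] [InnerProductSpace ℝ V]
    [FiniteDimensional ℝ V] [MeasurableSpace V] [BorelSpace V] {x : V} (hx : ‖x‖ = 1) :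
    (stdGaussian V).map (fun g => inner ℝ g x) = gaussianReal 0 1 := by
  have : IsProbabilityMeasure ((stdGaussian V).map (fun g => inner ℝ g x)) :=
    Measure.isProbabilityMeasure_map (by fun_prop)
  apply Measure.ext_of_charFun
  ext s
  rw [charFun_apply_real, integral_map (by fun_prop) (by fun_prop), charFun_gaussianReal]
  have := charFun_stdGaussian (s • x)
  rw [charFun_apply, norm_smul, hx, mul_one, Real.norm_eq_abs] at this
  simp only [real_inner_smul_right, Complex.ofReal_mul] at this
  rw [this]
  congr 1
  norm_cast
  rw [sq_abs]
  simp; ring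

lemma exists_gaussianReal_abs_ge_le {ε : ℝ} (hε : 0 < ε) :
    ∃ κ : ℝ, 0 < κ ∧ (gaussianReal 0 1).real {s | κ ≤ |s|} ≤ ε := by
  have hint : Integrable (fun s : ℝ => |s|) (gaussianReal 0 1) :=
    (IsGaussian.integrable_fun_id (μ := gaussianReal 0 1)).abs
  set I := ∫ s, |s| ∂(gaussianReal 0 1)
  have hI : 0 ≤ I := integral_nonneg fun s => abs_nonneg s
  refine ⟨(I + 1) / ε, by positivity, ?_⟩
  have := mul_meas_ge_le_integral_of_nonneg
    (Filter.Eventually.of_forall fun s : ℝ => abs_nonneg s) hint ((I + 1) / ε)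
  rw [div_mul_eq_mul_div, div_le_iff₀ hε] at this
  nlinarith

end StandardGaussian

/-! ### Atypical measurements -/

section TypicalMeasurement

variable {E : Type*} [MeasurableSpace E] {Y : Set ℝ}

/-- The pairs `(s, e)` of a linear measurement and a random parameter for which the measurement or
the response is untypically large. A vanishing response is always typical, which matters if the
mean absolute response is `0`. -/
def atypicalSet (ν : Measure E) (f : E → ℝ → Y) (κ C : ℝ) : Set (ℝ × E) :=
  {p | κ ≤ |p.1|} ∪ {p | meanAbsResponse ν f ≠ ∞ ∧ (f p.2 p.1 : ℝ) ≠ 0 ∧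
    ENNReal.ofReal C * meanAbsResponse ν f ≤ ‖(f p.2 p.1 : ℝ)‖ₑ}

variable {ν : Measure E} {f : E → ℝ → Y}

lemma measurable_response (hf : Measurable (Function.uncurry f)) :
    Measurable (fun p : ℝ × E => (f p.2 p.1 : ℝ)) :=
  measurable_subtype_coe.comp (hf.comp measurable_swap)

lemma measurableSet_atypicalSet (hf : Measurable (Function.uncurry f)) (κ C : ℝ) :
    MeasurableSet (atypicalSet ν f κ C) := by
  have hm := measurable_response hf
  refine (measurableSet_le measurable_const (by fun_prop)).union ?_
  exact (MeasurableSet.const _).inter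
    ((hm (measurableSet_singleton 0).compl).inter (measurableSet_le measurable_const hm.enorm))

lemma prod_atypicalSet_le [IsProbabilityMeasure ν] (hf : Measurable (Function.uncurry f))
    {κ C ε : ℝ} (hκ : (gaussianReal 0 1).real {s | κ ≤ |s|} ≤ ε) (hC : 0 < C) (hCε : C⁻¹ ≤ ε) :
    ((gaussianReal 0 1).prod ν).real (atypicalSet ν f κ C) ≤ ε + ε := by
  have hε : 0 ≤ ε := (inv_pos.2 hC).le.trans hCε
  refine (measureReal_union_le _ _).trans (add_le_add ?_ ?_)
  · have h1 : {p : ℝ × E | κ ≤ |p.1|} = {s : ℝ | κ ≤ |s|} ×ˢ Set.univ := by ext; simp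
    rw [h1, measureReal_prod_prod, probReal_univ, mul_one]
    exact hκ
  · refine ENNReal.toReal_le_of_le_ofReal hε ?_
    have hm := measurable_response hf
    have hmean : ∫⁻ p, ‖(f p.2 p.1 : ℝ)‖ₑ ∂((gaussianReal 0 1).prod ν) =
        meanAbsResponse ν f := lintegral_prod _ hm.enorm.aemeasurable
    by_cases htop : meanAbsResponse ν f = ∞
    · simp [htop]
    by_cases hzero : meanAbsResponse ν f = 0
    · have h0 : ∀ᵐ p ∂((gaussianReal 0 1).prod ν), (f p.2 p.1 : ℝ) = 0 := by
        rw [hzero, lintegral_eq_zero_iff hm.enorm] at hmean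
        filter_upwards [hmean] with p hp using by simpa using hp
      have : ((gaussianReal 0 1).prod ν) {p : ℝ × E | (f p.2 p.1 : ℝ) ≠ 0} = 0 := h0
      exact (measure_mono_null (fun p hp => hp.2.1) this).trans_le zero_le
    · have hC0 : ENNReal.ofReal C ≠ 0 := by simpa using hC
      calc ((gaussianReal 0 1).prod ν) {p : ℝ × E | meanAbsResponse ν f ≠ ∞ ∧
              (f p.2 p.1 : ℝ) ≠ 0 ∧
              ENNReal.ofReal C * meanAbsResponse ν f ≤ ‖(f p.2 p.1 : ℝ)‖ₑ}
          ≤ ((gaussianReal 0 1).prod ν) {p : ℝ × E |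
              ENNReal.ofReal C * meanAbsResponse ν f ≤ ‖(f p.2 p.1 : ℝ)‖ₑ} :=
            measure_mono fun p hp => hp.2.2
        _ ≤ meanAbsResponse ν f / (ENNReal.ofReal C * meanAbsResponse ν f) := by
            rw [← hmean]
            refine meas_ge_le_lintegral_div hm.enorm.aemeasurable ?_ ?_ <;> rw [hmean]
            · exact mul_ne_zero hC0 hzero
            · exact ENNReal.mul_ne_top ENNReal.ofReal_ne_top htop
        _ = ENNReal.ofReal C⁻¹ := by
            rw [ENNReal.ofReal_inv_of_pos hC, ENNReal.div_eq_inv_mul,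
              ENNReal.mul_inv (Or.inl hC0) (Or.inl ENNReal.ofReal_ne_top), mul_assoc,
              ENNReal.inv_mul_cancel hzero htop, mul_one]
        _ ≤ ENNReal.ofReal ε := ENNReal.ofReal_le_ofReal hCε

/-- If the response is typical, then a corrupted response `y` at distance at most `D` has absolute
value less than `N`. The condition `D < N` settles the case of a vanishing response, and it makes
`D` finite. -/
lemma enorm_lt_of_notMem_atypicalSet {κ C : ℝ} (hC : 0 < C) {p : ℝ × E}
    (hp : p ∉ atypicalSet ν f κ C) {N D : ℝ≥0∞}
    (hN : ENNReal.ofReal C * meanAbsResponse ν f + D ≤ N)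
    (hD : D < N) {y : ℝ} (hy : ‖(f p.2 p.1 : ℝ) - y‖ₑ ≤ D) : ‖y‖ₑ < N := by
  have htri : ‖y‖ₑ ≤ ‖(f p.2 p.1 : ℝ)‖ₑ + ‖(f p.2 p.1 : ℝ) - y‖ₑ := by
    have := enorm_sub_le (a := (f p.2 p.1 : ℝ)) (b := (f p.2 p.1 : ℝ) - y)
    simpa using this
  by_cases htop : meanAbsResponse ν f = ∞
  · have : N = ∞ := by
      rw [htop, ENNReal.mul_top (by simpa using hC), top_add] at hN
      exact top_le_iff.1 hN
    rw [this]; exact enorm_lt_top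
  by_cases hzero : (f p.2 p.1 : ℝ) = 0
  · rw [hzero, enorm_zero, zero_add] at htri
    rw [hzero] at hy
    exact (htri.trans hy).trans_lt hD
  · have hlt : ‖(f p.2 p.1 : ℝ)‖ₑ < ENNReal.ofReal C * meanAbsResponse ν f := by
      by_contra hcon
      exact hp (Or.inr ⟨htop, hzero, not_lt.1 hcon⟩)
    refine lt_of_lt_of_le ?_ hN
    refine htri.trans_lt (ENNReal.add_lt_add_of_lt_of_le ?_ hlt hy)
    exact (hy.trans_lt (hD.trans_le le_top)).ne

end TypicalMeasurement

/-! ### Restricted strong convexity -/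

section RestrictedStrongConvexity

/-- The contribution of a typical measurement `s` in a direction whose measurement is `τ`. The
hypothesis `hs` makes room for the increment `t * τ`, as `τ ≤ 3` wherever `tent τ ≠ 0`. -/
lemma mul_tent_le_taylor_remainder {Y : Set ℝ} {L : ℝ → Y → ℝ} {c t : ℝ} {M N : ℝ≥0∞}
    (hL : ∀ y, ContDiff ℝ 2 (fun v => L v y)) (hL_conv : ∀ y, ConvexOn ℝ Set.univ (fun v => L v y))
    (hc : 0 < c) (ht : 0 < t)
    (hcL : ∀ (v : ℝ) (y : Y), ‖v‖ₑ < M → ‖(y : ℝ)‖ₑ < N → c ≤ iteratedDeriv 2 (fun u => L u y) v)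
    {y : Y} (hy : ‖(y : ℝ)‖ₑ < N) {s τ : ℝ} (hs : ∀ v, |v| ≤ |s| + 3 * t → ‖v‖ₑ < M) :
    c / 2 * t ^ 2 * tent τ ≤
      L (s + t * τ) y - L s y - deriv (fun v => L v y) s * (s + t * τ - s) := by
  rcases (tent_nonneg τ).eq_or_lt with h0 | h0
  · have := (hL_conv y).add_mul_sub_le_of_hasDerivAt (Set.mem_univ s) (Set.mem_univ (s + t * τ))
      ((hL y).differentiable (by norm_num) s).hasDerivAt
    rw [← h0, mul_zero]
    linarith
  · obtain ⟨h1, h3⟩ := mem_Ioo_of_tent_pos h0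
    refine le_trans ?_ (mul_sq_le_taylor_remainder (hL y) (x := s) (y := s + t * τ) (c := c) ?_)
    · have hsq : tent τ ≤ τ ^ 2 := (tent_le_one τ).trans (by nlinarith)
      have : c / 2 * (s + t * τ - s) ^ 2 = c / 2 * t ^ 2 * τ ^ 2 := by ring
      rw [this]
      gcongr
    · intro v hv
      refine hcL v y (hs v ?_) hy
      rw [Set.uIcc_of_le (by nlinarith)] at hv
      have h4 : t * τ ≤ 3 * t := by nlinarith
      rw [abs_le]
      constructor <;> linarith [hv.1, hv.2, neg_abs_le s, le_abs_self s]

lemma enorm_lt_of_abs_le {κ μ t s v : ℝ} {M : ℝ≥0∞} (ht : 0 < t) (hκ : 0 < κ)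
    (hM : max (ENNReal.ofReal (32 * t)) (ENNReal.ofReal (2 * κ * |μ|)) ≤ M)
    (hs : |s| ≤ κ * |μ|) (hv : |v| ≤ |s| + 3 * t) : ‖v‖ₑ < M := by
  refine lt_of_lt_of_le ?_ hM
  rw [Real.enorm_eq_ofReal_abs, lt_max_iff]
  have hμ : 0 ≤ κ * |μ| := by positivity
  by_cases h : |v| < 32 * t
  · exact Or.inl ((ENNReal.ofReal_lt_ofReal_iff (by positivity)).2 h)
  · have h' : |v| < 2 * κ * |μ| := by linarith
    exact Or.inr ((ENNReal.ofReal_lt_ofReal_iff (by linarith [abs_nonneg v])).2 h')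

/-- The exponent of Chernoff's bound for the parameter `b = η / 2` and a deviation of `η m`: the
lower bound on `m` makes the width term at most a quarter of the deviation term. -/
lemma exponent_le {m W t η : ℝ} (hm : 0 ≤ m) (hη : 0 < η)
    (hW : 64 / η ^ 2 * (W ^ 2 / t ^ 2) ≤ m) :
    m * ((η / 2) ^ 2 / 2) + η / 2 * (2 * √m * (W / t)) - η / 2 * (η * m) ≤ -(η ^ 2 / 4) * m := by
  have h1 : (W / t) ^ 2 ≤ (√m * (η / 8)) ^ 2 := by
    rw [mul_pow, Real.sq_sqrt hm, div_pow]
    have h64 : 64 / η ^ 2 * (W ^ 2 / t ^ 2) = 64 * (W ^ 2 / t ^ 2) / η ^ 2 := by ring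
    rw [h64, div_le_iff₀ (by positivity)] at hW
    linarith
  have h2 : W / t ≤ √m * (η / 8) :=
    (le_abs_self _).trans (abs_le_of_sq_le_sq h1 (by positivity))
  have h3 : √m * (W / t) ≤ m * (η / 8) := by
    calc √m * (W / t) ≤ √m * (√m * (η / 8)) := by gcongr
      _ = m * (η / 8) := by rw [← mul_assoc, Real.mul_self_sqrt hm]
  nlinarith

/-- The probabilistic half of the argument: with high probability, for every unit direction `v` of
the index set, the tent function counts many more measurements than there are atypical ones. -/
lemma exists_event_forall_sum_tent_ge {n m : ℕ} {Ω E : Type*} [MeasurableSpace Ω]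
    [MeasurableSpace E] {P : Measure Ω} [IsProbabilityMeasure P] {ν : Measure E}
    [IsProbabilityMeasure ν] {Y : Set ℝ} {f : E → ℝ → Y}
    {a : Fin m → Ω → EuclideanSpace ℝ (Fin n)} {ξ : Fin m → Ω → E}
    (hmodel : IsGaussianSingleIndexModel P ν f a ξ) {x₀ : EuclideanSpace ℝ (Fin n)}
    (hx₀ : ‖x₀‖ = 1) {S : Set (ℝ × E)} (hS : MeasurableSet S) {p η t : ℝ}
    (hSp : ((gaussianReal 0 1).prod ν).real S ≤ p) (hη : 0 < η) (ht : 0 < t)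
    {T : Set (EuclideanSpace ℝ (Fin n))}
    (hm : 64 / η ^ 2 * localEffectiveDim t T ≤ m) :
    ∃ A : Set Ω, MeasurableSet A ∧ 1 - Real.exp (-(η ^ 2 / 4) * m) ≤ P.real A ∧
      ∀ ω ∈ A, ∀ v : EuclideanSpace ℝ (Fin n), ‖v‖ = 1 → t • v ∈ T →
        m * ((∫ s, tent s ∂(gaussianReal 0 1)) - p - η) ≤
          ∑ j, (tent (inner ℝ (a j ω) v) -
            S.indicator 1 ((inner ℝ (a j ω) x₀ : ℝ), ξ j ω)) := by
  set q := ∫ s, tent s ∂(gaussianReal 0 1)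
  set π : Measure (EuclideanSpace ℝ (Fin n) × E) :=
    (stdGaussian (EuclideanSpace ℝ (Fin n))).prod ν with hπ
  set φ : EuclideanSpace ℝ (Fin n) × E → ℝ × E := Prod.map (fun g => inner ℝ g x₀) id with hφ
  have hφm : Measurable φ := Measurable.prodMap (by fun_prop) measurable_id
  have hφπ : π.map φ = (gaussianReal 0 1).prod ν := by
    rw [hπ, hφ, ← Measure.map_prod_map _ _ (by fun_prop) measurable_id,
      map_inner_stdGaussian hx₀, Measure.map_id]
  have hSm : Measurable (fun z => S.indicator (1 : ℝ × E → ℝ) (φ z)) :=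
    (measurable_one.indicator hS).comp hφm
  set F : EuclideanSpace ℝ (Fin n) × E → EuclideanSpace ℝ (Fin n) → ℝ :=
    fun z v => tent (inner ℝ z.1 v) - S.indicator 1 (φ z) with hF
  have hind : ∀ z, S.indicator (1 : ℝ × E → ℝ) z ∈ Set.Icc 0 1 := fun z =>
    ⟨Set.indicator_nonneg (fun _ _ => zero_le_one) _,
      Set.indicator_le_self' (fun _ _ => zero_le_one) _⟩
  have hmean : ∀ v : EuclideanSpace ℝ (Fin n), ‖v‖ = 1 →
      ∫ z, F z v ∂π = q - ((gaussianReal 0 1).prod ν).real S := by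
    intro v hv
    have h1 : Integrable (fun g : EuclideanSpace ℝ (Fin n) => tent (inner ℝ g v))
        (stdGaussian (EuclideanSpace ℝ (Fin n))) := by
      refine Integrable.comp_measurable
        (f := fun g : EuclideanSpace ℝ (Fin n) => (inner ℝ g v : ℝ)) (g := tent) ?_ (by fun_prop)
      rw [map_inner_stdGaussian hv]
      exact integrable_tent
    have h2 : Integrable (fun z => S.indicator (1 : ℝ × E → ℝ) (φ z)) π :=
      Integrable.of_bound hSm.aestronglyMeasurable 1 (Filter.Eventually.of_forall fun z => by
        rw [Real.norm_of_nonneg (hind _).1]; exact (hind _).2)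
    have h3 : ∫ z, S.indicator (1 : ℝ × E → ℝ) (φ z) ∂π =
        ((gaussianReal 0 1).prod ν).real S := by
      rw [← integral_map (f := S.indicator (1 : ℝ × E → ℝ)) hφm.aemeasurable
        (measurable_one.indicator hS).aestronglyMeasurable, hφπ, integral_indicator_one hS]
    have h4 : ∫ z : EuclideanSpace ℝ (Fin n) × E, tent (inner ℝ z.1 v) ∂π = q := by
      rw [hπ, integral_fun_fst (fun g : EuclideanSpace ℝ (Fin n) => tent (inner ℝ g v)),
        probReal_univ, one_smul,
        ← integral_map (φ := fun g : EuclideanSpace ℝ (Fin n) => (inner ℝ g v : ℝ)) (f := tent)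
          (by fun_prop) continuous_tent.aestronglyMeasurable, map_inner_stdGaussian hv]
    rw [hF, integral_sub (h1.comp_fst ν) h2, h3, h4]
  obtain ⟨B, hB, hPB, hBall⟩ := exists_measurableSet_sum_sub_le π (A := Prod.fst) measurable_fst
    (by rw [hπ, Measure.map_fst_prod, measure_univ, one_smul]) (F := F)
    (fun v => (continuous_tent.measurable.comp (by fun_prop)).sub hSm)
    (fun z => (continuous_tent.comp (by fun_prop)).sub continuous_const)
    (fun z v => by
      rw [hF, abs_le]
      constructor <;> linarith [(hind (φ z)).1, (hind (φ z)).2, tent_nonneg (inner ℝ z.1 v),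
        tent_le_one (inner ℝ z.1 v)])
    (fun z v v' => by
      simp only [hF, sub_sub_sub_cancel_right]
      exact tent_sub_le _ _)
    (T := {v | ‖v‖ = 1 ∧ t • v ∈ T}) (fun v hv => hmean v hv.1) (b := η / 2) (by positivity) m
    (η * m) (w := localMeanWidth t T / t) (fun k h hh =>
      integral_iSup_inner_le_localMeanWidth ht (fun i => (hh i).1.le) fun i => (hh i).2)
  have hpair : ∀ j, Measurable (fun ω => (a j ω, ξ j ω)) := fun j =>
    (hmodel.measurable_a j).prodMk (hmodel.measurable_ξ j)
  have hΦm : Measurable (fun ω j => (a j ω, ξ j ω)) := measurable_pi_lambda _ hpair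
  have hlaw : P.map (fun ω j => (a j ω, ξ j ω)) = Measure.pi fun _ => π := by
    rw [(iIndepFun_iff_map_fun_eq_pi_map fun j => (hpair j).aemeasurable).1 hmodel.indep]
    congr 1
    ext1 j
    rw [(indepFun_iff_map_prod_eq_prod_map_map (hmodel.measurable_a j).aemeasurable
      (hmodel.measurable_ξ j).aemeasurable).1 (hmodel.indep_a_ξ j), hmodel.map_a, hmodel.map_ξ]
  refine ⟨((fun ω j => (a j ω, ξ j ω)) ⁻¹' B)ᶜ, (hΦm hB).compl, ?_, fun ω hω v hv hvT => ?_⟩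
  · rw [probReal_compl_eq_one_sub (hΦm hB)]
    refine sub_le_sub_left ?_ _
    refine ENNReal.toReal_le_of_le_ofReal (Real.exp_pos _).le ?_
    rw [← Measure.map_apply hΦm hB, hlaw]
    exact hPB.trans (ENNReal.ofReal_le_ofReal (Real.exp_le_exp.2
      (exponent_le m.cast_nonneg hη hm)))
  · have h1 := hBall _ hω v ⟨hv, hvT⟩
    rw [Finset.sum_sub_distrib, Finset.sum_const, Finset.card_univ, Fintype.card_fin,
      nsmul_eq_mul] at h1
    have h2 : (m : ℝ) * ((gaussianReal 0 1).prod ν).real S ≤ m * p := by gcongr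
    have h3 : ∑ j, F (a j ω, ξ j ω) v = ∑ j, (tent (inner ℝ (a j ω) v) -
            S.indicator 1 ((inner ℝ (a j ω) x₀ : ℝ), ξ j ω)) := rfl
    rw [← h3]
    linarith

end RestrictedStrongConvexity

theorem mainTheorem2 :
    ∃ (C₁ C₂ C₃ C₄ : ℝ) (R : ℝ → ℝ),
      0 < C₁ ∧ 0 < C₂ ∧ 0 < C₃ ∧ 0 < C₄ ∧ (∀ c, 0 < c → 0 < R c) ∧
      ∀ (n m : ℕ) (Ω E : Type*) [MeasurableSpace Ω] [MeasurableSpace E]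
        (P : Measure Ω) [IsProbabilityMeasure P] (ν : Measure E) [IsProbabilityMeasure ν]
        (Y : Set ℝ) (f : E → ℝ → Y)
        (a : Fin m → Ω → EuclideanSpace ℝ (Fin n)) (ξ : Fin m → Ω → E)
        (y' : Ω → Fin m → Y)
        (L : ℝ → Y → ℝ) (K : Set (EuclideanSpace ℝ (Fin n)))
        (x₀ : EuclideanSpace ℝ (Fin n)) (μ t : ℝ) (M N : ℝ≥0∞) (c : ℝ),
        IsGaussianSingleIndexModel P ν f a ξ →
        IsRegularConvexLoss L →
        ‖x₀‖ = 1 →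
        μ • x₀ ∈ K →
        0 < t →
        (∀ y, ContDiff ℝ 2 (fun v => L v y)) →
        0 < M →
        0 < N →
        max (ENNReal.ofReal (32 * t)) (ENNReal.ofReal (C₁ * |μ|)) ≤ M →
        0 < c →
        (∀ (v : ℝ) (y : Y), ‖v‖ₑ < M → ‖(y : ℝ)‖ₑ < N →
          c ≤ iteratedDeriv 2 (fun u => L u y) v) →
        C₃ * localEffectiveDim t ((fun x => x - μ • x₀) '' K) ≤ (m : ℝ) →
        ∃ A : Set Ω, MeasurableSet A ∧ 1 - Real.exp (-C₄ * (m : ℝ)) ≤ P.real A ∧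
          ∀ ω ∈ A,
            ENNReal.ofReal C₂ * meanAbsResponse ν f
                + supDist (observation f a ξ x₀ ω) (y' ω) ≤ N →
            supDist (observation f a ξ x₀ ω) (y' ω) < N →
            SatisfiesRSCWith (R c) L (fun i => a i ω) (y' ω) K (μ • x₀) t := by
  set q := ∫ s, tent s ∂(gaussianReal 0 1)
  have hq : 0 < q := integral_tent_pos
  obtain ⟨κ, hκ, hκq⟩ := exists_gaussianReal_abs_ge_le (ε := q / 8) (by positivity)
  -- Each of the two causes of an atypical measurement gets probability `q / 8`, and the deviation
  -- may be `q / 4` per measurement, so that `q / 2` of the mean `q` of the tent remains.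
  refine ⟨2 * κ, 8 / q, 64 / (q / 4) ^ 2, (q / 4) ^ 2 / 4, fun c => q / 4 * c, by positivity,
    by positivity, by positivity, by positivity, fun c hc => by positivity, ?_⟩
  intro n m Ω E _ _ P _ ν _ Y f a ξ y' L K x₀ μ t M N c hmodel hL hx₀ _ ht hL2 _ _ hM hc hcL hm
  have hC₂ : 0 < 8 / q := by positivity
  -- Without measurements the empirical loss vanishes, and the bound allows the empty event.
  rcases m.eq_zero_or_pos with rfl | hmpos
  · exact ⟨∅, MeasurableSet.empty, by simp, by simp⟩
  have hm0 : (0 : ℝ) < m := by exact_mod_cast hmpos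
  obtain ⟨A, hA, hPA, hsum⟩ := exists_event_forall_sum_tent_ge hmodel hx₀
    (measurableSet_atypicalSet hmodel.measurable_f κ (8 / q))
    (prod_atypicalSet_le (ν := ν) hmodel.measurable_f hκq hC₂ (by rw [inv_div]))
    (by positivity : 0 < q / 4) ht hm
  refine ⟨A, hA, hPA, fun ω hω hN hD => ⟨by positivity, ?_⟩⟩
  rintro x ⟨hxK, hxt⟩
  have hxnorm : ‖x - μ • x₀‖ = t := by rwa [mem_sphere_iff_norm] at hxt
  set v := t⁻¹ • (x - μ • x₀) with hv
  have htv : t • v = x - μ • x₀ := by rw [hv, smul_inv_smul₀ ht.ne']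
  have hvnorm : ‖v‖ = 1 := by
    rw [hv, norm_smul, hxnorm, norm_inv, Real.norm_of_nonneg ht.le, inv_mul_cancel₀ ht.ne']
  have hcount := hsum ω hω v hvnorm (by rw [htv]; exact Set.mem_image_of_mem _ hxK)
  have hinner : ∀ j, (inner ℝ (a j ω) x : ℝ) =
      inner ℝ (a j ω) (μ • x₀) + t * inner ℝ (a j ω) v := by
    intro j
    rw [← real_inner_smul_right, htv, ← inner_add_right, add_sub_cancel]
  rw [hxnorm, taylorError_eq_sum (fun y => (hL2 y).differentiable (by norm_num))]
  have hterm : ∀ j, c / 2 * t ^ 2 * (tent (inner ℝ (a j ω) v) -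
      (atypicalSet ν f κ (8 / q)).indicator 1 ((inner ℝ (a j ω) x₀ : ℝ), ξ j ω)) ≤
      L (inner ℝ (a j ω) x) (y' ω j) - L (inner ℝ (a j ω) (μ • x₀)) (y' ω j) -
        deriv (fun v => L v (y' ω j)) (inner ℝ (a j ω) (μ • x₀)) *
          (inner ℝ (a j ω) x - inner ℝ (a j ω) (μ • x₀)) := by
    intro j
    by_cases hj : ((inner ℝ (a j ω) x₀ : ℝ), ξ j ω) ∈ atypicalSet ν f κ (8 / q)
    · -- An atypical measurement contributes a nonpositive amount on the left, and by convexity a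
      -- nonnegative one on the right.
      have h1 := (hL.convex (y' ω j)).add_mul_sub_le_of_hasDerivAt
        (Set.mem_univ (inner ℝ (a j ω) (μ • x₀))) (Set.mem_univ (inner ℝ (a j ω) x))
        ((hL2 (y' ω j)).differentiable (by norm_num) _).hasDerivAt
      rw [Set.indicator_of_mem hj, Pi.one_apply]
      have h2 : c / 2 * t ^ 2 * (tent (inner ℝ (a j ω) v) - 1) ≤ 0 :=
        mul_nonpos_of_nonneg_of_nonpos (by positivity) (sub_nonpos.2 (tent_le_one _))
      linarith
    · have hy : ‖(y' ω j : ℝ)‖ₑ < N :=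
        enorm_lt_of_notMem_atypicalSet hC₂ hj hN hD
          (le_iSup (fun i => ‖(observation f a ξ x₀ ω i : ℝ) - (y' ω i : ℝ)‖ₑ) j)
      have hs : |(inner ℝ (a j ω) (μ • x₀) : ℝ)| ≤ κ * |μ| := by
        have : ¬ κ ≤ |(inner ℝ (a j ω) x₀ : ℝ)| := fun h => hj (Or.inl h)
        rw [real_inner_smul_right, abs_mul, mul_comm]
        gcongr
        exact (not_le.1 this).le
      rw [Set.indicator_of_notMem hj, sub_zero, hinner j]
      exact mul_tent_le_taylor_remainder hL2 hL.convex hc ht hcL hy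
        fun v hv => enorm_lt_of_abs_le ht hκ hM hs hv
  calc q / 4 * c * t ^ 2
      = (1 / (m : ℝ)) * (c / 2 * t ^ 2 * (m * (q - (q / 8 + q / 8) - q / 4))) := by
        field_simp; ring
    _ ≤ (1 / (m : ℝ)) * (c / 2 * t ^ 2 * ∑ j, (tent (inner ℝ (a j ω) v) -
          (atypicalSet ν f κ (8 / q)).indicator 1 ((inner ℝ (a j ω) x₀ : ℝ), ξ j ω))) := by
        gcongr
    _ ≤ _ := by
        rw [Finset.mul_sum]
        gcongr with j
        exact hterm j
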